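/- Let $\mathcal H$ be a real or complex Hilbert space and let $T$ be a positive symmetric operator in $\mathcal H$ with dense domain $\mathcal D = \operatorname{dom} T$, that is, $\langle Tg,h\rangle=\langle g,Th\rangle$ and $\langle Tg,g\rangle\ge 0$ for all $g,h\in\mathcal D$. Put $\mathfrak t(g,h)=\langle Tg,h\rangle$ for $g,h\in\mathcal D$ and $\ker\mathfrak t=\{g\in\mathcal D:\mathfrak t(g,g)=0\}$, let $\mathcal H_{\mathfrak t}$ be the Hilbert space completion of $\mathcal D/\ker\mathfrak t$ with respect to the inner product $\langle g+\ker\mathfrak t,h+\ker\mathfrak t\rangle_{\mathfrak t}=\mathfrak t(g,h)$, and let $Q:\mathcal H\supseteq\mathcal D\to\mathcal H_{\mathfrak t}$ be the operator $Qg=g+\ker\mathfrak t$. Then $Q^*$ is densely defined, and the operator $T_F:=Q^*Q^{**}$, with its natural domain $\{g\in\operatorname{dom}Q^{**}: Q^{**}g\in\operatorname{dom}Q^*\}$, has the following properties: (a) $T\subset T_F$ and $T_F$ is a positive self-adjoint operator, that is, $T_F$ is a positive self-adjoint extension of $T$; (b) $S\preceq T_F$ for every positive self-adjoint extension $S$ of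 $T$. Here, for positive self-adjoint operators $A$ and $B$ in $\mathcal H$, $A\preceq B$ means that $\operatorname{dom}B^{1/2}\subseteq\operatorname{dom}A^{1/2}$ and $\|A^{1/2}h\|^2\le\|B^{1/2}h\|^2$ for all $h\in\operatorname{dom}B^{1/2}$, where $A^{1/2}$ denotes the positive self-adjoint square root of $A$. -/

import Mathlib

open scoped LinearPMap

noncomputable section

namespace FormExt

variable {𝕜 : Type*} [RCLike 𝕜]

/-! ### The auxiliary Hilbert space of a nonnegative symmetric form -/

section FormSpace

variable {H : Type*} [NormedAddCommGroup H] [InnerProductSpace 𝕜 H]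

/-- The subspace `D` of `H`, forgetting the norm of `H` and carrying instead the semi-inner product
given by the nonnegative symmetric form `t` on `D`. -/
def FormDomain {D : Submodule 𝕜 H} (_t : PreInnerProductSpace.Core 𝕜 D) : Type _ := D

variable {D : Submodule 𝕜 H} (t : PreInnerProductSpace.Core 𝕜 D)

instance : SeminormedAddCommGroup (FormDomain t) :=
  @InnerProductSpace.Core.toSeminormedAddCommGroup 𝕜 D _ _ _ t

instance : InnerProductSpace 𝕜 (FormDomain t) :=
  InnerProductSpace.ofCore t

/-- The Hilbert space of the form `t`: the completion of `D / ker t`. The separation quotient of a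
seminormed space is its quotient by the vectors of norm zero, here `{x | t x x = 0} = ker t`. -/
abbrev FormSpace : Type _ :=
  UniformSpace.Completion (SeparationQuotient (FormDomain t))

/-- `D` as a linear space is `FormDomain t`. -/
def toFormDomain : D →ₗ[𝕜] FormDomain t where
  toFun x := x
  map_add' _ _ := rfl
  map_smul' _ _ := rfl

/-- The canonical operator `Q` from `H`, with domain `D`, to the Hilbert space of the form `t`:
`Q g = g + ker t`. -/
def canonicalMap : H →ₗ.[𝕜] FormSpace t where
  domain := D
  toFun :=
    (UniformSpace.Completion.toComplₗᵢ (𝕜 := 𝕜)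
        (E := SeparationQuotient (FormDomain t))).toLinearMap ∘ₗ
      (SeparationQuotient.mkCLM 𝕜 (FormDomain t)).toLinearMap ∘ₗ toFormDomain t

end FormSpace

/-! ### Unbounded operators -/

section Operators

variable {E F G : Type*} [NormedAddCommGroup E] [InnerProductSpace 𝕜 E]
  [NormedAddCommGroup F] [InnerProductSpace 𝕜 F] [NormedAddCommGroup G] [InnerProductSpace 𝕜 G]

/-- The product `A B` of two operators on its natural domain `{x ∈ dom B | B x ∈ dom A}`. -/
def opMul (A : F →ₗ.[𝕜] G) (B : E →ₗ.[𝕜] F) : E →ₗ.[𝕜] G where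
  domain := (A.domain.comap B.toFun).map B.domain.subtype
  toFun :=
    { toFun := fun x => A ⟨B ⟨x, by obtain ⟨y, _, hy⟩ := x.2; exact hy ▸ y.2⟩, by
        obtain ⟨x, y, hy, rfl⟩ := x; exact hy⟩
      map_add' := fun x y => by
        rw [← A.map_add]
        congr 1
        ext
        exact B.map_add ⟨x, _⟩ ⟨y, _⟩
      map_smul' := fun c x => by
        rw [RingHom.id_apply, ← A.map_smul]
        congr 1
        ext
        exact B.map_smul c ⟨x, _⟩ }

/-- `T` is symmetric: `⟪T x, y⟫ = ⟪x, T y⟫` for all `x, y ∈ dom T`. -/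
def IsSymm (T : E →ₗ.[𝕜] E) : Prop := T.IsFormalAdjoint T

/-- `T` is positive: `⟪T x, x⟫ ≥ 0` for all `x ∈ dom T`. It is used for symmetric `T`, where
`⟪T x, x⟫` is automatically real. -/
def IsPos (T : E →ₗ.[𝕜] E) : Prop :=
  ∀ x : T.domain, 0 ≤ RCLike.re (inner 𝕜 (T x) (x : E))

/-- The form `(g, h) ↦ ⟪T g, h⟫` on `dom T` of a positive symmetric operator `T`. -/
@[reducible]
def formOf (T : E →ₗ.[𝕜] E) (hs : IsSymm T) (hp : IsPos T) :
    PreInnerProductSpace.Core 𝕜 T.domain where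
  inner g h := inner 𝕜 (T g) (h : E)
  conj_inner_symm g h := by rw [inner_conj_symm, hs g h]
  re_inner_nonneg := hp
  add_left x y z := by rw [T.map_add, inner_add_left]
  smul_left x y c := by rw [T.map_smul, inner_smul_left]

variable [CompleteSpace E]

/-- `T` is a positive self-adjoint operator. -/
def IsPosSelfAdjoint (T : E →ₗ.[𝕜] E) : Prop := IsSelfAdjoint T ∧ IsPos T

/-- `R = T ^ (1/2)`, the positive self-adjoint operator with `R R = T` (with the equality of
domains included). -/
def IsSqrt (R T : E →ₗ.[𝕜] E) : Prop := IsPosSelfAdjoint R ∧ opMul R R = T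

/-- The form order `S ⪯ T` of positive self-adjoint operators:
`dom T ^ (1/2) ⊆ dom S ^ (1/2)` and `‖S ^ (1/2) h‖ ^ 2 ≤ ‖T ^ (1/2) h‖ ^ 2` on `dom T ^ (1/2)`.
The existence of the two square roots is part of the assertion. -/
def FormLE (S T : E →ₗ.[𝕜] E) : Prop :=
  ∃ A B : E →ₗ.[𝕜] E, IsSqrt A S ∧ IsSqrt B T ∧
    ∃ hdom : B.domain ≤ A.domain,
      ∀ h : B.domain, ‖A ⟨h, hdom h.2⟩‖ ^ 2 ≤ ‖B h‖ ^ 2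

end Operators

end FormExt

end

/-! By symmetry of `T`, `⟪Q h, Q g⟫ = ⟪T h, g⟫ = ⟪h, T g⟫`, so `Q†` contains each pair `(Q g, T g)`.
As `Q` has dense range, `Q†` is densely defined, and `T ⊂ Q†Q††`. Since `Q††† = Q†`, this product is
`P†P` with `P = Q††` closed, so von Neumann's theorem makes it positive and self-adjoint.

For the order, write `Q_T`, `Q_S` for the canonical maps. The forms of `T` and `S` agree on `dom T`,
a core of `Q_T††`, so `Q_T††` dominates `Q_S††` (`dominates_canonicalMap`). A self-adjoint `S` has
no proper self-adjoint extension, so `S = Q_S†Q_S††`. Finally `P†P` determines `dom P` and `‖P x‖`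
(`dominates_of_adjoint_mul_self_le`), so both `Q††` may be exchanged for square roots.

Existence of the roots is proved over `ℝ` and `ℂ` alike: a power series treats bounded operators,
and the resolvent `(1 + S)⁻¹` reduces the general case to it. -/

namespace FormExt

/-! ### Square roots of bounded operators by power series -/

section BoundedSqrt

/-- The coefficients in `1 - √(1 - x) = x * ∑ aₙ xⁿ`. -/
noncomputable def sqrtCoeff (n : ℕ) : ℝ := catalan n / (2 * 4 ^ n)

theorem sqrtCoeff_nonneg (n : ℕ) : 0 ≤ sqrtCoeff n := by
  unfold sqrtCoeff; positivity

/-- The Catalan recursion, which encodes `2g = 1 + x g²` for the generating function `g`. -/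
theorem sqrtCoeff_succ (n : ℕ) :
    2 * sqrtCoeff (n + 1) =
      ∑ p ∈ Finset.HasAntidiagonal.antidiagonal n, sqrtCoeff p.1 * sqrtCoeff p.2 := by
  have h : ∀ p ∈ Finset.HasAntidiagonal.antidiagonal n, sqrtCoeff p.1 * sqrtCoeff p.2
      = (catalan p.1 * catalan p.2 : ℝ) / (4 * 4 ^ n) := by
    intro p hp
    rw [Finset.HasAntidiagonal.mem_antidiagonal] at hp
    rw [← hp, pow_add]
    unfold sqrtCoeff
    field_simp
    ring
  rw [Finset.sum_congr rfl h, ← Finset.sum_div]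
  unfold sqrtCoeff
  rw [catalan_succ']
  push_cast
  field_simp
  ring

/-- The closed form bounds the partial sums by 1, so the series converges even when `‖b‖ = 1`. -/
theorem sum_range_sqrtCoeff (n : ℕ) :
    ∑ k ∈ Finset.range n, sqrtCoeff k = 1 - n.centralBinom / 4 ^ n := by
  induction n with
  | zero => simp
  | succ n ih =>
    rw [Finset.sum_range_succ, ih]
    unfold sqrtCoeff
    have h1 : ((n : ℝ) + 1) * (n + 1).centralBinom = 2 * (2 * n + 1) * n.centralBinom := by
      exact_mod_cast Nat.succ_mul_centralBinom_succ n
    have h2 : ((n : ℝ) + 1) * catalan n = n.centralBinom := by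
      exact_mod_cast succ_mul_catalan_eq_centralBinom n
    have h3 : (0 : ℝ) < n + 1 := by positivity
    rw [← h2] at h1 ⊢
    have h4 : ((n + 1).centralBinom : ℝ) = 2 * (2 * n + 1) * catalan n := by
      apply mul_left_cancel₀ h3.ne'
      rw [h1]; ring
    rw [h4, pow_succ]
    field_simp
    ring

theorem sum_range_sqrtCoeff_le (n : ℕ) : ∑ k ∈ Finset.range n, sqrtCoeff k ≤ 1 := by
  rw [sum_range_sqrtCoeff]
  have : (0 : ℝ) ≤ n.centralBinom / 4 ^ n := by positivity
  linarith

theorem summable_sqrtCoeff : Summable sqrtCoeff :=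
  summable_of_sum_range_le sqrtCoeff_nonneg sum_range_sqrtCoeff_le

variable {𝕜 : Type*} [RCLike 𝕜]

theorem summable_norm_sqrtSeries {A : Type*} [NormedRing A] [NormOneClass A] [NormedAlgebra 𝕜 A]
    {b : A} (hb : ‖b‖ ≤ 1) : Summable fun n => ‖(sqrtCoeff n : 𝕜) • b ^ n‖ := by
  refine Summable.of_nonneg_of_le (fun _ => norm_nonneg _) (fun n => ?_) summable_sqrtCoeff
  rw [norm_smul, RCLike.norm_ofReal, abs_of_nonneg (sqrtCoeff_nonneg n)]
  exact mul_le_of_le_one_right (sqrtCoeff_nonneg n)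
    ((norm_pow_le b n).trans (pow_le_one₀ (norm_nonneg b) hb))

theorem norm_tsum_sqrtSeries_le {A : Type*} [NormedRing A] [NormOneClass A] [NormedAlgebra 𝕜 A]
    {b : A} (hb : ‖b‖ ≤ 1) : ‖∑' n, (sqrtCoeff n : 𝕜) • b ^ n‖ ≤ 1 := by
  refine tsum_of_norm_bounded (g := sqrtCoeff) (a := ∑' n, sqrtCoeff n)
    summable_sqrtCoeff.hasSum (fun n => ?_) |>.trans
    (summable_sqrtCoeff.tsum_le_of_sum_range_le sum_range_sqrtCoeff_le)
  rw [norm_smul, RCLike.norm_ofReal, abs_of_nonneg (sqrtCoeff_nonneg n)]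
  exact mul_le_of_le_one_right (sqrtCoeff_nonneg n)
    ((norm_pow_le b n).trans (pow_le_one₀ (norm_nonneg b) hb))

/-- With `g` the sum of the series, this is what makes `(1 - b g)² = 1 - b (2g - b g²) = 1 - b`. -/
theorem two_smul_tsum_sqrtSeries {A : Type*} [NormedRing A] [NormOneClass A] [NormedAlgebra 𝕜 A]
    [CompleteSpace A] {b : A} (hb : ‖b‖ ≤ 1) :
    (2 : 𝕜) • ∑' n, (sqrtCoeff n : 𝕜) • b ^ n
      = 1 + b * ((∑' n, (sqrtCoeff n : 𝕜) • b ^ n) * ∑' n, (sqrtCoeff n : 𝕜) • b ^ n) := by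
  have hs := summable_norm_sqrtSeries (𝕜 := 𝕜) hb
  have hsq : ∀ n, ∑ p ∈ Finset.HasAntidiagonal.antidiagonal n,
      ((sqrtCoeff p.1 : 𝕜) • b ^ p.1) * ((sqrtCoeff p.2 : 𝕜) • b ^ p.2)
      = (2 : 𝕜) • (sqrtCoeff (n + 1) : 𝕜) • b ^ n := by
    intro n
    have h : ((2 * sqrtCoeff (n + 1) : ℝ) : 𝕜)
        = ((∑ p ∈ Finset.HasAntidiagonal.antidiagonal n, sqrtCoeff p.1 * sqrtCoeff p.2 : ℝ) : 𝕜) := by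
      rw [sqrtCoeff_succ]
    push_cast at h
    rw [smul_smul, h, Finset.sum_smul]
    refine Finset.sum_congr rfl fun p hp => ?_
    rw [Finset.HasAntidiagonal.mem_antidiagonal] at hp
    rw [smul_mul_smul_comm, ← pow_add, hp]
  have hsq' : Summable fun n => (2 : 𝕜) • (sqrtCoeff (n + 1) : 𝕜) • b ^ n := by
    simp_rw [← hsq]
    exact (summable_norm_sum_mul_antidiagonal_of_summable_norm hs hs).of_norm
  rw [tsum_mul_tsum_eq_tsum_sum_antidiagonal_of_summable_norm hs hs]
  simp_rw [hsq]
  rw [← hsq'.tsum_mul_left, hs.of_norm.tsum_eq_zero_add, smul_add,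
    ← ((summable_nat_add_iff 1).2 hs.of_norm).tsum_const_smul]
  congr 1
  · have h : (2 : 𝕜) * (sqrtCoeff 0 : 𝕜) = 1 := by
      rw [show sqrtCoeff 0 = 1 / 2 by norm_num [sqrtCoeff]]
      push_cast
      norm_num
    rw [pow_zero, smul_smul, h, one_smul]
  · refine tsum_congr fun n => ?_
    rw [mul_smul_comm, mul_smul_comm, pow_succ']

/-- A self-adjoint contraction `B` has a self-adjoint contraction `Y` in its bicommutant such that
`(1 - Y)² = 1 - B`. -/
theorem exists_sqrt_one_sub {H : Type*} [NormedAddCommGroup H] [InnerProductSpace 𝕜 H]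
    [CompleteSpace H] {B : H →L[𝕜] H} (hB : IsSelfAdjoint B) (hB1 : ‖B‖ ≤ 1) :
    ∃ Y : H →L[𝕜] H, IsSelfAdjoint Y ∧ ‖Y‖ ≤ 1 ∧ (1 - Y) * (1 - Y) = 1 - B ∧
      ∀ Z : H →L[𝕜] H, Commute Z B → Commute Z Y := by
  -- `NormOneClass` fails for operators on the zero space.
  cases subsingleton_or_nontrivial H with
  | inl _ => exact ⟨B, hB, hB1, Subsingleton.elim _ _, fun _ h => h⟩
  | inr _ =>
    set g : H →L[𝕜] H := ∑' n, (sqrtCoeff n : 𝕜) • B ^ n with hg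
    have hs := (summable_norm_sqrtSeries (𝕜 := 𝕜) hB1).of_norm
    have hcomm : ∀ Z : H →L[𝕜] H, Commute Z B → Commute Z g := fun Z hZ => by
      rw [commute_iff_eq, hg, ← hs.tsum_mul_left, ← hs.tsum_mul_right]
      refine tsum_congr fun n => ?_
      rw [mul_smul_comm, smul_mul_assoc, (hZ.pow_right n).eq]
    have hgs : IsSelfAdjoint g := by
      rw [IsSelfAdjoint, hg, tsum_star]
      refine tsum_congr fun n => ?_
      rw [star_smul, star_pow, hB.star_eq, RCLike.star_def, RCLike.conj_ofReal]
    have hBg : Commute B g := hcomm B (Commute.refl B)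
    refine ⟨B * g, ?_, ?_, ?_, fun Z hZ => hZ.mul_right (hcomm Z hZ)⟩
    · rw [IsSelfAdjoint, star_mul, hB.star_eq, hgs.star_eq, hBg.eq]
    · exact (norm_mul_le _ _).trans
        (mul_le_one₀ hB1 (norm_nonneg _) (norm_tsum_sqrtSeries_le hB1))
    · have h := two_smul_tsum_sqrtSeries (𝕜 := 𝕜) hB1
      rw [← hg, two_smul] at h
      have h2 : B * g * (B * g) = B * (B * (g * g)) := by
        rw [mul_assoc, ← mul_assoc g, ← hBg.eq, mul_assoc]
      have h3 : B * (B * (g * g)) = B * g + B * g - B := by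
        rw [← mul_add, h, mul_add, mul_one]; abel
      rw [sub_mul, mul_sub, mul_sub, h2, h3]
      simp only [one_mul, mul_one]
      abel

theorem re_inner_one_sub_nonneg {H : Type*} [NormedAddCommGroup H] [InnerProductSpace 𝕜 H]
    {Y : H →L[𝕜] H} (hY : ‖Y‖ ≤ 1) (x : H) : 0 ≤ RCLike.re (inner 𝕜 ((1 - Y) x) x) := by
  have h : RCLike.re (inner 𝕜 (Y x) x) ≤ ‖x‖ * ‖x‖ :=
    (re_inner_le_norm _ _).trans
      (mul_le_mul_of_nonneg_right ((Y.le_of_opNorm_le hY x).trans (one_mul _).le) (norm_nonneg _))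
  rw [sub_apply, inner_sub_left, map_sub]
  rw [show ((1 : H →L[𝕜] H) x) = x from rfl, inner_self_eq_norm_mul_norm]
  linarith

end BoundedSqrt

/-! ### Operators through their graphs -/

section GraphCalculus

variable {𝕜 : Type*} [RCLike 𝕜]
variable {E F G : Type*} [NormedAddCommGroup E] [InnerProductSpace 𝕜 E]
  [NormedAddCommGroup F] [InnerProductSpace 𝕜 F] [NormedAddCommGroup G] [InnerProductSpace 𝕜 G]

theorem mem_graph_opMul {A : F →ₗ.[𝕜] G} {B : E →ₗ.[𝕜] F} {x : E} {z : G} :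
    (x, z) ∈ (opMul A B).graph ↔ ∃ y, (x, y) ∈ B.graph ∧ (y, z) ∈ A.graph := by
  constructor
  · intro h
    obtain ⟨⟨x', hx'⟩, rfl, rfl⟩ := (LinearPMap.mem_graph_iff _).1 h
    obtain ⟨y, hy, rfl⟩ := id hx'
    exact ⟨B y, B.mem_graph y, A.mem_graph ⟨B y, hy⟩⟩
  · rintro ⟨y, h1, h2⟩
    obtain ⟨x', rfl, rfl⟩ := (LinearPMap.mem_graph_iff _).1 h1
    obtain ⟨y', hy : (y' : F) = B x', rfl⟩ := (LinearPMap.mem_graph_iff _).1 h2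
    have hx : (x' : E) ∈ (opMul A B).domain := by
      refine ⟨x', ?_, rfl⟩
      change B x' ∈ A.domain
      exact hy ▸ y'.2
    refine (LinearPMap.mem_graph_iff _).2 ⟨⟨x', hx⟩, rfl, ?_⟩
    change A ⟨B x', _⟩ = A y'
    congr 1
    exact Subtype.ext hy.symm

theorem isSymm_iff_graph {A : E →ₗ.[𝕜] E} :
    IsSymm A ↔ ∀ p ∈ A.graph, ∀ q ∈ A.graph, inner 𝕜 p.2 q.1 = inner 𝕜 p.1 q.2 := by
  constructor
  · rintro h ⟨x, y⟩ hp ⟨x', y'⟩ hq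
    obtain ⟨u, rfl, rfl⟩ := (LinearPMap.mem_graph_iff _).1 hp
    obtain ⟨v, rfl, rfl⟩ := (LinearPMap.mem_graph_iff _).1 hq
    exact h u v
  · exact fun h x y => h _ (A.mem_graph x) _ (A.mem_graph y)

theorem isPos_iff_graph {A : E →ₗ.[𝕜] E} :
    IsPos A ↔ ∀ p ∈ A.graph, 0 ≤ RCLike.re (inner 𝕜 p.2 p.1) := by
  constructor
  · rintro h ⟨x, y⟩ hp
    obtain ⟨u, rfl, rfl⟩ := (LinearPMap.mem_graph_iff _).1 hp
    exact h u
  · exact fun h x => h _ (A.mem_graph x)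

theorem mem_graph_adjoint [CompleteSpace E] {A : E →ₗ.[𝕜] F} (hA : Dense (A.domain : Set E))
    {y : F} {z : E} :
    (y, z) ∈ A†.graph ↔ ∀ p ∈ A.graph, inner 𝕜 p.2 y = inner 𝕜 p.1 z := by
  rw [LinearPMap.adjoint_graph_eq_graph_adjoint hA, Submodule.mem_adjoint_iff]
  simp only [sub_eq_zero, Prod.forall]

theorem inner_adjoint_graph [CompleteSpace E] {A : E →ₗ.[𝕜] F} (hA : Dense (A.domain : Set E))
    {x : E} {w y : F} {z : E} (hp : (x, w) ∈ A.graph) (hq : (y, z) ∈ A†.graph) :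
    inner 𝕜 w y = inner 𝕜 x z :=
  (mem_graph_adjoint hA).1 hq _ hp

theorem dense_of_forall_inner_eq_zero [CompleteSpace E] {K : Submodule 𝕜 E}
    (h : ∀ x, (∀ u ∈ K, inner 𝕜 u x = 0) → x = 0) : Dense (K : Set E) := by
  rw [Submodule.dense_iff_topologicalClosure_eq_top, Submodule.topologicalClosure_eq_top_iff,
    Submodule.eq_bot_iff]
  exact fun x hx => h x ((Submodule.mem_orthogonal K x).1 hx)

/-- A positive symmetric operator `A` with `1 + A` surjective is self-adjoint. -/
theorem isPosSelfAdjoint_of_surjective [CompleteSpace E] {A : E →ₗ.[𝕜] E} (hs : IsSymm A)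
    (hp : IsPos A) (hsurj : ∀ x, ∃ u, (u, x - u) ∈ A.graph) : IsPosSelfAdjoint A := by
  have hs' := isSymm_iff_graph.1 hs
  have hp' := isPos_iff_graph.1 hp
  have hd : Dense (A.domain : Set E) := by
    -- If `x ⟂ dom A` and `x = u + A u`, then `0 ≤ re ⟪A u, u⟫ = -‖u‖²`, so `u = 0` and `x = A 0 =
    -- 0`.
    refine dense_of_forall_inner_eq_zero fun x hx => ?_
    obtain ⟨u, hu⟩ := hsurj x
    have h1 := hx u (LinearPMap.mem_domain_of_mem_graph hu)
    have h2 := hp' _ hu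
    simp only [inner_sub_left, map_sub] at h2
    rw [← inner_conj_symm, h1, map_zero, map_zero, zero_sub, inner_self_eq_norm_sq (𝕜 := 𝕜)] at h2
    have h3 : u = 0 := by
      rw [← norm_eq_zero, ← sq_eq_zero_iff]
      exact le_antisymm (by linarith) (sq_nonneg _)
    rw [h3, sub_zero] at hu
    exact A.graph_fst_eq_zero_snd hu rfl
  refine ⟨?_, hp⟩
  rw [LinearPMap.isSelfAdjoint_def]
  apply le_antisymm
  · rw [← LinearPMap.le_graph_iff]
    rintro ⟨y, z⟩ hyz
    -- The candidate `u` solves `u + A u = y + z`. Writing `y - u = v + A v` and moving `A` across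
    -- gives `‖y - u‖² = 0`.
    obtain ⟨u, hu⟩ := hsurj (y + z)
    have hadj := (mem_graph_adjoint hd).1 hyz
    obtain ⟨v, hv⟩ := hsurj (y - u)
    have h1 := hadj _ hv
    have h2 := hs' _ hv _ hu
    simp only at h1 h2
    have h3 : inner 𝕜 (y - u) (y - u) = 0 := by
      have e : inner 𝕜 (y - u) (y - u) = inner 𝕜 (y - u - v) y - inner 𝕜 (y - u - v) u
          + inner 𝕜 v y - inner 𝕜 v u := by
        simp only [inner_sub_left, inner_sub_right]; ring
      rw [e, h1, h2]
      simp only [inner_sub_right, inner_add_right]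
      ring
    have h4 : y = u := sub_eq_zero.1 (inner_self_eq_zero.1 h3)
    subst h4
    simpa using hu
  · exact LinearPMap.IsFormalAdjoint.le_adjoint hd hs

end GraphCalculus

/-! ### Square roots of unbounded operators -/

section SquareRoot

variable {𝕜 : Type*} [RCLike 𝕜] {E : Type*} [NormedAddCommGroup E] [InnerProductSpace 𝕜 E]
  [CompleteSpace E]

/-- The resolvent `J = (1 + S)⁻¹` of a positive self-adjoint operator `S`. -/
theorem exists_resolvent {S : E →ₗ.[𝕜] E} (hS : IsPosSelfAdjoint S)
    (hsurj : ∀ x, ∃ u, (u, x - u) ∈ S.graph) :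
    ∃ J : E →L[𝕜] E, IsSelfAdjoint J ∧ ‖J‖ ≤ 1 ∧ ‖1 - J‖ ≤ 1 ∧
      ∀ x, (J x, x - J x) ∈ S.graph := by
  have hsym : ∀ p ∈ S.graph, ∀ q ∈ S.graph, inner 𝕜 p.2 q.1 = inner 𝕜 p.1 q.2 := by
    rintro ⟨x, y⟩ hp ⟨x', y'⟩ hq
    have h := hS.1
    rw [LinearPMap.isSelfAdjoint_def] at h
    rw [← h] at hq
    exact inner_adjoint_graph hS.1.dense_domain hp hq
  have hpos := isPos_iff_graph.1 hS.2
  -- Positivity makes the cross term of `‖u + v‖²` nonnegative; hence both `J` and `1 - J` are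
  -- contractions.
  have key : ∀ u v, (u, v) ∈ S.graph → ‖u‖ ≤ ‖u + v‖ ∧ ‖v‖ ≤ ‖u + v‖ := by
    intro u v h
    have h1 := hpos _ h
    have h2 := norm_add_sq (𝕜 := 𝕜) u v
    rw [inner_re_symm] at h2
    simp only at h1
    constructor <;> refine (sq_le_sq₀ (norm_nonneg _) (norm_nonneg _)).1 ?_ <;>
      nlinarith [sq_nonneg ‖u‖, sq_nonneg ‖v‖]
  choose f hf using hsurj
  have huniq : ∀ x u, (u, x - u) ∈ S.graph → u = f x := by
    intro x u h
    have h1 := S.graph.sub_mem h (hf x)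
    have h2 := (key (u - f x) ((x - u) - (x - f x)) h1).1
    rw [show u - f x + (x - u - (x - f x)) = 0 by abel, norm_zero] at h2
    exact sub_eq_zero.1 (norm_le_zero_iff.1 h2)
  let J₀ : E →ₗ[𝕜] E :=
    { toFun := f
      map_add' := fun x y => by
        refine (huniq _ _ ?_).symm
        convert S.graph.add_mem (hf x) (hf y) using 1
        ext <;> simp
        abel
      map_smul' := fun c x => by
        refine (huniq _ _ ?_).symm
        convert S.graph.smul_mem c (hf x) using 1
        ext <;> simp [smul_sub] }
  have hb : ∀ x, ‖J₀ x‖ ≤ 1 * ‖x‖ := fun x => by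
    have h := (key _ _ (hf x)).1
    rw [add_sub_cancel] at h
    rwa [one_mul]
  refine ⟨J₀.mkContinuous 1 hb, ?_, LinearMap.mkContinuous_norm_le _ zero_le_one hb, ?_, hf⟩
  · rw [ContinuousLinearMap.isSelfAdjoint_iff_isSymmetric]
    intro x y
    change inner 𝕜 (f x) y = inner 𝕜 x (f y)
    have h := hsym _ (hf x) _ (hf y)
    simp only [inner_sub_left, inner_sub_right] at h
    exact (sub_left_injective h).symm
  · refine ContinuousLinearMap.opNorm_le_bound _ zero_le_one fun x => ?_
    have h := (key _ _ (hf x)).2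
    rw [add_sub_cancel] at h
    rwa [one_mul]

/-- A positive self-adjoint operator `S` with `1 + S` surjective has a positive self-adjoint square
root, namely `(1 - J)^(1/2) J^(-1/2)` with `J = (1 + S)⁻¹`. -/
theorem exists_isSqrt {S : E →ₗ.[𝕜] E} (hS : IsPosSelfAdjoint S)
    (hsurj : ∀ x, ∃ u, (u, x - u) ∈ S.graph) : ∃ R : E →ₗ.[𝕜] E, IsSqrt R S := by
  obtain ⟨J, hJ, hJ1, hJ1', hJS⟩ := exists_resolvent hS hsurj
  -- Below, `C = 1 - Y = J^(1/2)`, `D = 1 - Z = (1 - J)^(1/2)` and `V = 1 - W = C^(1/2)`. The root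
  -- `V` serves only for positivity: `⟪D x, C x⟫ = ⟪D (V x), V x⟫`.
  obtain ⟨Y, hY, hY1, hYJ, hYc⟩ :=
    exists_sqrt_one_sub (B := 1 - J) ((IsSelfAdjoint.one _).sub hJ) hJ1'
  obtain ⟨Z, hZ, hZ1, hZJ, hZc⟩ := exists_sqrt_one_sub hJ hJ1
  obtain ⟨W, hW, -, hWY, hWc⟩ := exists_sqrt_one_sub hY hY1
  rw [sub_sub_cancel] at hYJ
  have hZY : Commute Z Y := hYc Z ((Commute.one_right Z).sub_right (hZc J (Commute.refl J)).symm)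
  have hZW : Commute Z W := hWc Z hZY
  have hC : IsSelfAdjoint (1 - Y) := (IsSelfAdjoint.one _).sub hY
  have hD : IsSelfAdjoint (1 - Z) := (IsSelfAdjoint.one _).sub hZ
  have hV : IsSelfAdjoint (1 - W) := (IsSelfAdjoint.one _).sub hW
  have hDC : Commute (1 - Z) (1 - Y) :=
    (Commute.one_left _).sub_left ((Commute.one_right _).sub_right hZY)
  have hDV : Commute (1 - Z) (1 - W) :=
    (Commute.one_left _).sub_left ((Commute.one_right _).sub_right hZW)
  have hDpos := re_inner_one_sub_nonneg hZ1
  generalize 1 - Y = C at *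
  generalize 1 - Z = D at *
  generalize 1 - W = V at *
  have hCC : ∀ x, C (C x) = J x := fun x => DFunLike.congr_fun hYJ x
  have hDD : ∀ x, D (D x) = x - J x := fun x => DFunLike.congr_fun hZJ x
  have hVV : ∀ x, V (V x) = C x := fun x => DFunLike.congr_fun hWY x
  have hDCx : ∀ x, D (C x) = C (D x) := fun x => DFunLike.congr_fun hDC x
  have hDVx : ∀ x, D (V x) = V (D x) := fun x => DFunLike.congr_fun hDV x
  have hCs : ∀ x y, inner 𝕜 (C x) y = inner 𝕜 x (C y) :=
    ContinuousLinearMap.isSelfAdjoint_iff_isSymmetric.1 hC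
  have hDs : ∀ x y, inner 𝕜 (D x) y = inner 𝕜 x (D y) :=
    ContinuousLinearMap.isSelfAdjoint_iff_isSymmetric.1 hD
  have hVs : ∀ x y, inner 𝕜 (V x) y = inner 𝕜 x (V y) :=
    ContinuousLinearMap.isSelfAdjoint_iff_isSymmetric.1 hV
  have hJinj : ∀ x, J x = 0 → x = 0 := fun x hx => by
    have h := hJS x
    rw [hx, sub_zero] at h
    exact S.graph_fst_eq_zero_snd h rfl
  have hCinj : ∀ x, C x = 0 → x = 0 := fun x hx => hJinj x (by rw [← hCC, hx, map_zero])
  let R : E →ₗ.[𝕜] E := (LinearMap.range (C.toLinearMap.prod D.toLinearMap)).toLinearPMap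
  have hR' : R.graph = LinearMap.range (C.toLinearMap.prod D.toLinearMap) := by
    apply Submodule.toLinearPMap_graph_eq
    rintro _ ⟨x, rfl⟩ hx
    change D x = 0
    rw [hCinj x hx, map_zero]
  have hR : ∀ y z, (y, z) ∈ R.graph ↔ ∃ x, C x = y ∧ D x = z := fun y z => by
    rw [hR']
    simp [LinearMap.mem_range, LinearMap.prod_apply, Prod.ext_iff]
  have hRd : Dense (R.domain : Set E) := by
    refine dense_of_forall_inner_eq_zero fun x hx => hCinj x ?_
    have h := hx (C (C x)) (LinearPMap.mem_domain_of_mem_graph ((hR _ _).2 ⟨C x, rfl, rfl⟩))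
    rw [hCs] at h
    exact inner_self_eq_zero.1 h
  refine ⟨R, ⟨?_, ?_⟩, ?_⟩
  · rw [LinearPMap.isSelfAdjoint_def]
    apply LinearPMap.eq_of_eq_graph
    ext ⟨y, z⟩
    rw [mem_graph_adjoint hRd]
    constructor
    · intro h
      have h1 : C z = D y := by
        refine ext_inner_left 𝕜 fun x => ?_
        rw [← hCs, ← hDs]
        exact (h (C x, D x) ((hR _ _).2 ⟨x, rfl, rfl⟩)).symm
      -- Forced by `C² + D² = 1`: if `C x = y` and `D x = z`, then `x = C y + D z`.
      refine (hR _ _).2 ⟨C y + D z, ?_, ?_⟩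
      · rw [map_add, hCC, ← hDCx, h1, hDD, add_sub_cancel]
      · rw [map_add, hDCx, ← h1, hCC, hDD, add_sub_cancel]
    · rintro h ⟨p, q⟩ hp
      obtain ⟨x, rfl, rfl⟩ := (hR _ _).1 h
      obtain ⟨w, rfl, rfl⟩ := (hR _ _).1 hp
      simp only
      rw [hDs, hCs, hDCx]
  · rw [isPos_iff_graph]
    rintro ⟨p, q⟩ hp
    obtain ⟨x, rfl, rfl⟩ := (hR _ _).1 hp
    simp only
    rw [← hVV x, ← hVs, ← hDVx]
    exact hDpos (V x)
  · apply LinearPMap.eq_of_eq_graph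
    ext ⟨y, z⟩
    rw [mem_graph_opMul]
    constructor
    · rintro ⟨w, h1, h2⟩
      obtain ⟨a, rfl, rfl⟩ := (hR _ _).1 h1
      obtain ⟨b, hb, rfl⟩ := (hR _ _).1 h2
      have ha : C (C a + D b) = a := by
        rw [map_add, hCC, ← hDCx, hb, hDD, add_sub_cancel]
      have hDb : D b = (C a + D b) - J (C a + D b) := by
        rw [← hCC, ha]; abel
      have h := hJS (C a + D b)
      rwa [← hDb, ← hCC, ha] at h
    · intro h
      have h1 : y = J (y + z) := by
        have h2 := S.graph.sub_mem h (hJS (y + z))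
        have h3 : ∀ v, (v, -v) ∈ S.graph → v = 0 := fun v hv => by
          have h4 := isPos_iff_graph.1 hS.2 _ hv
          simp only [inner_neg_left, map_neg] at h4
          rw [inner_self_eq_norm_sq] at h4
          rw [← norm_eq_zero, ← sq_eq_zero_iff]
          exact le_antisymm (by linarith) (sq_nonneg _)
        refine sub_eq_zero.1 (h3 _ ?_)
        convert h2 using 1
        ext <;> simp
        abel
      refine ⟨D (C (y + z)), (hR _ _).2 ⟨C (y + z), ?_, rfl⟩, (hR _ _).2 ⟨D (y + z), ?_, ?_⟩⟩
      · rw [hCC, ← h1]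
      · rw [hDCx]
      · rw [hDD, ← h1, add_sub_cancel_left]

end SquareRoot

/-! ### Von Neumann's theorem, cores and domination -/

section VonNeumann

variable {𝕜 : Type*} [RCLike 𝕜]
variable {E F G : Type*} [NormedAddCommGroup E] [InnerProductSpace 𝕜 E]
  [NormedAddCommGroup F] [InnerProductSpace 𝕜 F] [NormedAddCommGroup G] [InnerProductSpace 𝕜 G]

/-- A subspace of a closed graph with trivial orthogonal complement in it is dense in it. -/
theorem graph_le_topologicalClosure [CompleteSpace E] [CompleteSpace F] {P : E →ₗ.[𝕜] F}
    (hP : P.IsClosed) {D : Submodule 𝕜 (E × F)} (hD : D ≤ P.graph)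
    (horth : ∀ p ∈ P.graph, (∀ q ∈ D, inner 𝕜 q.1 p.1 + inner 𝕜 q.2 p.2 = 0) → p = 0) :
    P.graph ≤ D.topologicalClosure := by
  intro p hp
  -- The product carries the sup norm; orthogonal projection needs the Hilbert norm of `WithLp 2`.
  let e := WithLp.linearEquiv 2 𝕜 (E × F)
  have hcont : Continuous e := WithLp.prod_continuous_ofLp _ _ _
  let K : Submodule 𝕜 (WithLp 2 (E × F)) := D.topologicalClosure.comap e.toLinearMap
  have hKc : IsClosed (K : Set (WithLp 2 (E × F))) :=
    D.isClosed_topologicalClosure.preimage hcont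
  have : CompleteSpace K := hKc.completeSpace_coe
  have hDP : D.topologicalClosure ≤ P.graph := D.topologicalClosure_minimal hD hP
  have hpr : e (K.starProjection (e.symm p)) ∈ D.topologicalClosure :=
    K.starProjection_apply_mem (e.symm p)
  have h0 : p - e (K.starProjection (e.symm p)) = 0 := by
    refine horth _ (P.graph.sub_mem hp (hDP hpr)) fun q hq => ?_
    have hqK : e.symm q ∈ K := D.le_topologicalClosure hq
    have h := K.inner_right_of_mem_orthogonal hqK
      (K.sub_starProjection_mem_orthogonal (e.symm p))
    rw [WithLp.prod_inner_apply] at h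
    exact h
  rw [sub_eq_zero.1 h0]
  exact hpr

/-- `1 + P†P` is surjective for a closed densely defined operator `P`. -/
theorem exists_mem_graph_adjoint_mul_self [CompleteSpace E] [CompleteSpace F] {P : E →ₗ.[𝕜] F}
    (hP : P.IsClosed) (hd : Dense (P.domain : Set E)) (x : E) :
    ∃ u, (u, x - u) ∈ (opMul P† P).graph := by
  let e := WithLp.linearEquiv 2 𝕜 (E × F)
  have hcont : Continuous e := WithLp.prod_continuous_ofLp _ _ _
  let K : Submodule 𝕜 (WithLp 2 (E × F)) := P.graph.comap e.toLinearMap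
  have hKc : IsClosed (K : Set (WithLp 2 (E × F))) := IsClosed.preimage hcont hP
  have : CompleteSpace K := hKc.completeSpace_coe
  -- The residual `(x - k.1, -k.2)` is orthogonal to the graph of `P`, which says `P† k.2 = x -
  -- k.1`.
  set k := e (K.starProjection (e.symm (x, 0))) with hk
  have hkP : (k.1, k.2) ∈ P.graph := K.starProjection_apply_mem (e.symm (x, 0))
  refine ⟨k.1, mem_graph_opMul.2 ⟨k.2, hkP, (mem_graph_adjoint hd).2 fun q hq => ?_⟩⟩
  have h := K.inner_right_of_mem_orthogonal (u := e.symm q) (show e.symm q ∈ K from hq)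
    (K.sub_starProjection_mem_orthogonal (e.symm (x, 0)))
  rw [WithLp.prod_inner_apply] at h
  change inner 𝕜 q.1 (x - k.1) + inner 𝕜 q.2 (0 - k.2) = 0 at h
  rw [zero_sub, inner_neg_right, ← sub_eq_add_neg, sub_eq_zero] at h
  exact h.symm

/-- Von Neumann's theorem: `P†P` is positive and self-adjoint. -/
theorem isPosSelfAdjoint_adjoint_mul_self [CompleteSpace E] [CompleteSpace F] {P : E →ₗ.[𝕜] F}
    (hP : P.IsClosed) (hd : Dense (P.domain : Set E)) : IsPosSelfAdjoint (opMul P† P) := by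
  refine isPosSelfAdjoint_of_surjective ?_ ?_ (exists_mem_graph_adjoint_mul_self hP hd)
  · rw [isSymm_iff_graph]
    rintro ⟨x, z⟩ hx ⟨x', z'⟩ hx'
    obtain ⟨y, h1, h2⟩ := mem_graph_opMul.1 hx
    obtain ⟨y', h1', h2'⟩ := mem_graph_opMul.1 hx'
    simp only
    rw [← inner_adjoint_graph hd h1 h2', ← inner_conj_symm, ← inner_adjoint_graph hd h1' h2,
      inner_conj_symm]
  · rw [isPos_iff_graph]
    rintro ⟨x, z⟩ hx
    obtain ⟨y, h1, h2⟩ := mem_graph_opMul.1 hx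
    simp only
    rw [inner_re_symm, ← inner_adjoint_graph hd h1 h2]
    exact inner_self_nonneg

/-- `P` dominates `Q`: `dom P ⊆ dom Q` and `‖Q x‖ ≤ ‖P x‖` on `dom P`. -/
def Dominates (P : E →ₗ.[𝕜] F) (Q : E →ₗ.[𝕜] G) : Prop :=
  ∀ p ∈ P.graph, ∃ w, (p.1, w) ∈ Q.graph ∧ ‖w‖ ≤ ‖p.2‖

theorem Dominates.trans {K : Type*} [NormedAddCommGroup K] [InnerProductSpace 𝕜 K]
    {P : E →ₗ.[𝕜] F} {Q : E →ₗ.[𝕜] G} {R : E →ₗ.[𝕜] K} (h1 : Dominates P Q)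
    (h2 : Dominates Q R) : Dominates P R := fun p hp => by
  obtain ⟨w, hw, hle⟩ := h1 p hp
  obtain ⟨v, hv, hle'⟩ := h2 _ hw
  exact ⟨v, hv, hle'.trans hle⟩

/-- Domination by `P` of a closed operator may be checked on a core of `P`. -/
theorem dominates_of_core [CompleteSpace G] {P : E →ₗ.[𝕜] F} {Q : E →ₗ.[𝕜] G} (hQ : Q.IsClosed)
    {D : Submodule 𝕜 (E × F)} (hD : P.graph ≤ D.topologicalClosure)
    (h : ∀ q ∈ D, ∃ w, (q.1, w) ∈ Q.graph ∧ ‖w‖ ≤ ‖q.2‖) : Dominates P Q := by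
  intro p hp
  obtain ⟨q, hqD, hq⟩ := mem_closure_iff_seq_limit.1 (hD hp)
  choose w hw hwle using fun n => h (q n) (hqD n)
  -- The bound on differences makes `w` Cauchy; closedness of `Q` then identifies its limit.
  have hdiff : ∀ n m, ‖w n - w m‖ ≤ ‖(q n).2 - (q m).2‖ := fun n m => by
    obtain ⟨v, hv, hvle⟩ := h _ (D.sub_mem (hqD n) (hqD m))
    rwa [Q.mem_graph_snd_inj (Q.graph.sub_mem (hw n) (hw m)) hv rfl]
  have hq2 : Filter.Tendsto (fun n => (q n).2) Filter.atTop (nhds p.2) :=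
    (continuous_snd.tendsto p).comp hq
  have hcau : CauchySeq w := by
    rw [Metric.cauchySeq_iff]
    intro ε hε
    obtain ⟨N, hN⟩ := Metric.cauchySeq_iff.1 hq2.cauchySeq ε hε
    refine ⟨N, fun m hm n hn => lt_of_le_of_lt ?_ (hN m hm n hn)⟩
    rw [dist_eq_norm, dist_eq_norm]
    exact hdiff m n
  obtain ⟨v, hv⟩ := cauchySeq_tendsto_of_complete hcau
  refine ⟨v, ?_, le_of_tendsto_of_tendsto' hv.norm hq2.norm hwle⟩
  exact hQ.mem_of_tendsto (((continuous_fst.tendsto p).comp hq).prodMk_nhds hv)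
    (Filter.Eventually.of_forall hw)

/-- If `P†P ⊆ Q†Q`, then `P` dominates `Q`. -/
theorem dominates_of_adjoint_mul_self_le [CompleteSpace E] [CompleteSpace F] [CompleteSpace G]
    {P : E →ₗ.[𝕜] F} {Q : E →ₗ.[𝕜] G} (hP : P.IsClosed) (hPd : Dense (P.domain : Set E))
    (hQ : Q.IsClosed) (hQd : Dense (Q.domain : Set E)) (h : opMul P† P ≤ opMul Q† Q) :
    Dominates P Q := by
  -- The graph of `P` restricted to `dom P†P`, where `‖P x‖² = ⟪P†P x, x⟫`. It is a core: if `(x, P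
  -- x)` is orthogonal to it, testing with `u = (1 + P†P)⁻¹ x` gives `⟪x, x⟫ = 0`.
  let D : Submodule 𝕜 (E × F) := P.graph ⊓ P†.domain.comap (LinearMap.snd 𝕜 E F)
  refine dominates_of_core (D := D) hQ (graph_le_topologicalClosure hP inf_le_left ?_) ?_
  · rintro ⟨x, y⟩ hp horth
    obtain ⟨u, hu⟩ := exists_mem_graph_adjoint_mul_self hP hPd x
    obtain ⟨v, h1, h2⟩ := mem_graph_opMul.1 hu
    have h3 := horth (u, v) ⟨h1, LinearPMap.mem_domain_of_mem_graph h2⟩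
    have h4 := inner_adjoint_graph hPd hp h2
    simp only at h3
    rw [← inner_conj_symm v y, h4, inner_conj_symm, ← inner_add_left, add_sub_cancel] at h3
    have hx : x = 0 := inner_self_eq_zero.1 h3
    subst hx
    rw [P.graph_fst_eq_zero_snd hp rfl, Prod.mk_zero_zero]
  · rintro ⟨x, y⟩ ⟨hq, hy⟩
    obtain ⟨z, hz⟩ := LinearPMap.mem_domain_iff.1 (show y ∈ P†.domain from hy)
    obtain ⟨w, h1, h2⟩ := mem_graph_opMul.1
      (LinearPMap.le_graph_of_le h (mem_graph_opMul.2 ⟨y, hq, hz⟩))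
    refine ⟨w, h1, (sq_le_sq₀ (norm_nonneg _) (norm_nonneg _)).1 (le_of_eq ?_)⟩
    rw [← inner_self_eq_norm_sq (𝕜 := 𝕜), ← inner_self_eq_norm_sq (𝕜 := 𝕜),
      inner_adjoint_graph hQd h1 h2]
    exact congrArg _ (inner_adjoint_graph hPd hq hz).symm

/-- The graph of a densely defined operator `P` with densely defined adjoint is dense in the graph
of `P††`. -/
theorem graph_adjoint_adjoint_le [CompleteSpace E] [CompleteSpace F] {P : E →ₗ.[𝕜] F}
    (hd : Dense (P.domain : Set E)) (hd' : Dense (P†.domain : Set F)) :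
    P††.graph ≤ P.graph.topologicalClosure := by
  refine graph_le_topologicalClosure (LinearPMap.adjoint_isClosed hd')
    (LinearPMap.le_graph_of_le
      (LinearPMap.IsFormalAdjoint.le_adjoint hd' (LinearPMap.adjoint_isFormalAdjoint hd))) ?_
  rintro ⟨x, y⟩ hp horth
  -- Orthogonality to the graph of `P` reads `P† y = -x`; pairing with `P†† x = y` gives `-‖x‖² =
  -- ‖y‖²`.
  have h1 : (y, -x) ∈ P†.graph := (mem_graph_adjoint hd).2 fun q hq => by
    rw [inner_neg_right, eq_neg_iff_add_eq_zero, add_comm]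
    exact horth q hq
  have h2 := inner_adjoint_graph hd' h1 hp
  rw [inner_neg_left, neg_eq_iff_add_eq_zero] at h2
  have h3 := congrArg RCLike.re h2
  rw [map_add, map_zero, inner_self_eq_norm_sq, inner_self_eq_norm_sq] at h3
  have hx : x = 0 := by
    rw [← norm_eq_zero, ← sq_eq_zero_iff]
    nlinarith [sq_nonneg ‖x‖, sq_nonneg ‖y‖]
  subst hx
  rw [LinearPMap.graph_fst_eq_zero_snd _ hp rfl, Prod.mk_zero_zero]

end VonNeumann

/-! ### The Friedrichs extension and its extremality -/

section FriedrichsExtension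

variable {𝕜 : Type*} [RCLike 𝕜] {H : Type*} [NormedAddCommGroup H] [InnerProductSpace 𝕜 H]

theorem inner_canonicalMap {D : Submodule 𝕜 H} (t : PreInnerProductSpace.Core 𝕜 D) (g h : D) :
    inner 𝕜 (canonicalMap t g) (canonicalMap t h) = t.inner g h := by
  refine (UniformSpace.Completion.inner_coe _ _).trans ?_
  rfl

theorem denseRange_canonicalMap {D : Submodule 𝕜 H} (t : PreInnerProductSpace.Core 𝕜 D) :
    DenseRange (canonicalMap t) :=
  (UniformSpace.Completion.denseRange_coe.comp
    (SeparationQuotient.surjective_mk (X := FormDomain t)).denseRange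
    (UniformSpace.Completion.continuous_coe _) :)

variable [CompleteSpace H] {T : H →ₗ.[𝕜] H}

theorem mem_graph_adjoint_canonicalMap (hd : Dense (T.domain : Set H)) (hs : IsSymm T)
    (hp : IsPos T) (g : T.domain) :
    (canonicalMap (formOf T hs hp) g, T g) ∈ (canonicalMap (formOf T hs hp))†.graph := by
  refine (mem_graph_adjoint (A := canonicalMap (formOf T hs hp)) hd).2 ?_
  rintro ⟨x, y⟩ hxy
  obtain ⟨h, rfl, rfl⟩ := (LinearPMap.mem_graph_iff _).1 hxy
  exact (inner_canonicalMap _ h g).trans (hs h g)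

theorem dense_domain_adjoint_canonicalMap (hd : Dense (T.domain : Set H)) (hs : IsSymm T)
    (hp : IsPos T) : Dense ((canonicalMap (formOf T hs hp))†.domain :
      Set (FormSpace (formOf T hs hp))) := by
  refine (denseRange_canonicalMap (formOf T hs hp)).mono ?_
  rintro _ ⟨g, rfl⟩
  exact LinearPMap.mem_domain_of_mem_graph (mem_graph_adjoint_canonicalMap hd hs hp g)

theorem dense_domain_adjoint_adjoint_canonicalMap (hd : Dense (T.domain : Set H)) (hs : IsSymm T)
    (hp : IsPos T) : Dense ((canonicalMap (formOf T hs hp))††.domain : Set H) :=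
  hd.mono (LinearPMap.IsFormalAdjoint.le_adjoint (dense_domain_adjoint_canonicalMap hd hs hp)
    (LinearPMap.adjoint_isFormalAdjoint hd)).1

theorem adjoint_adjoint_adjoint {F : Type*} [NormedAddCommGroup F] [InnerProductSpace 𝕜 F]
    [CompleteSpace F] {P : H →ₗ.[𝕜] F} (hd : Dense (P.domain : Set H))
    (hd' : Dense (P†.domain : Set F)) (hd'' : Dense (P††.domain : Set H)) : P††† = P† := by
  apply le_antisymm
  · refine LinearPMap.IsFormalAdjoint.le_adjoint hd fun x y => ?_
    have h := LinearPMap.le_graph_of_le (LinearPMap.IsFormalAdjoint.le_adjoint hd'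
      (LinearPMap.adjoint_isFormalAdjoint hd)) (P.mem_graph x)
    exact inner_adjoint_graph hd'' h (P†††.mem_graph y)
  · exact LinearPMap.IsFormalAdjoint.le_adjoint hd'' (LinearPMap.adjoint_isFormalAdjoint hd')

/-- The Friedrichs extension of `T`. -/
noncomputable def friedrichs (T : H →ₗ.[𝕜] H) (hs : IsSymm T) (hp : IsPos T) : H →ₗ.[𝕜] H :=
  opMul (canonicalMap (formOf T hs hp))† (canonicalMap (formOf T hs hp))††

theorem friedrichs_eq (hd : Dense (T.domain : Set H)) (hs : IsSymm T) (hp : IsPos T) :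
    friedrichs T hs hp =
      opMul (canonicalMap (formOf T hs hp))††† (canonicalMap (formOf T hs hp))†† := by
  rw [adjoint_adjoint_adjoint (P := canonicalMap (formOf T hs hp)) hd
    (dense_domain_adjoint_canonicalMap hd hs hp)
    (dense_domain_adjoint_adjoint_canonicalMap hd hs hp)]
  rfl

theorem isClosed_adjoint_adjoint_canonicalMap (hd : Dense (T.domain : Set H)) (hs : IsSymm T)
    (hp : IsPos T) : (canonicalMap (formOf T hs hp))††.IsClosed :=
  LinearPMap.adjoint_isClosed (dense_domain_adjoint_canonicalMap hd hs hp)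

theorem mem_graph_adjoint_adjoint_canonicalMap (hd : Dense (T.domain : Set H)) (hs : IsSymm T)
    (hp : IsPos T) (g : T.domain) :
    ((g : H), canonicalMap (formOf T hs hp) g) ∈ (canonicalMap (formOf T hs hp))††.graph :=
  LinearPMap.le_graph_of_le (LinearPMap.IsFormalAdjoint.le_adjoint
    (dense_domain_adjoint_canonicalMap hd hs hp) (LinearPMap.adjoint_isFormalAdjoint hd))
    ((canonicalMap (formOf T hs hp)).mem_graph g)

theorem le_friedrichs (hd : Dense (T.domain : Set H)) (hs : IsSymm T) (hp : IsPos T) :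
    T ≤ friedrichs T hs hp := by
  rw [← LinearPMap.le_graph_iff]
  rintro ⟨x, y⟩ hxy
  obtain ⟨g, rfl, rfl⟩ := (LinearPMap.mem_graph_iff _).1 hxy
  exact mem_graph_opMul.2 ⟨_, mem_graph_adjoint_adjoint_canonicalMap hd hs hp g,
    mem_graph_adjoint_canonicalMap hd hs hp g⟩

theorem isPosSelfAdjoint_friedrichs (hd : Dense (T.domain : Set H)) (hs : IsSymm T)
    (hp : IsPos T) : IsPosSelfAdjoint (friedrichs T hs hp) := by
  rw [friedrichs_eq hd]
  exact isPosSelfAdjoint_adjoint_mul_self (isClosed_adjoint_adjoint_canonicalMap hd hs hp)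
    (dense_domain_adjoint_adjoint_canonicalMap hd hs hp)

theorem IsPosSelfAdjoint.isSymm {S : H →ₗ.[𝕜] H} (hS : IsPosSelfAdjoint S) : IsSymm S := by
  have h := LinearPMap.adjoint_isFormalAdjoint hS.1.dense_domain
  rw [LinearPMap.isSelfAdjoint_def.1 hS.1] at h
  exact h

/-- A positive self-adjoint operator is its own Friedrichs extension. -/
theorem IsPosSelfAdjoint.friedrichs_eq_self {S : H →ₗ.[𝕜] H} (hS : IsPosSelfAdjoint S) :
    friedrichs S hS.isSymm hS.2 = S := by
  have hle := le_friedrichs hS.1.dense_domain hS.isSymm hS.2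
  have hF := isPosSelfAdjoint_friedrichs hS.1.dense_domain hS.isSymm hS.2
  refine le_antisymm ?_ hle
  -- Taking adjoints reverses `S ≤ friedrichs S`, and both sides are self-adjoint.
  have h : S.IsFormalAdjoint (friedrichs S hS.isSymm hS.2) := fun x y => by
    have h1 := hF.isSymm ⟨x, hle.1 x.2⟩ y
    rwa [← hle.2 (x := x) rfl] at h1
  have h2 := h.le_adjoint hS.1.dense_domain
  rwa [LinearPMap.isSelfAdjoint_def.1 hS.1] at h2

/-- Surjectivity of `1 + S` comes from writing `S` as `P†P` with `P` closed. -/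
theorem IsPosSelfAdjoint.exists_sqrt {S : H →ₗ.[𝕜] H} (hS : IsPosSelfAdjoint S) :
    ∃ R : H →ₗ.[𝕜] H, IsSqrt R S := by
  refine exists_isSqrt hS fun x => ?_
  rw [← hS.friedrichs_eq_self, friedrichs_eq hS.1.dense_domain]
  exact exists_mem_graph_adjoint_mul_self
    (isClosed_adjoint_adjoint_canonicalMap hS.1.dense_domain hS.isSymm hS.2)
    (dense_domain_adjoint_adjoint_canonicalMap hS.1.dense_domain hS.isSymm hS.2) x

theorem IsSqrt.adjoint_mul_self {R S : H →ₗ.[𝕜] H} (h : IsSqrt R S) : opMul R† R = S := by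
  rw [LinearPMap.isSelfAdjoint_def.1 h.1.1, h.2]

/-- The form of an extension `S` of `T` restricts to the form of `T`. -/
theorem dominates_canonicalMap (hd : Dense (T.domain : Set H)) (hs : IsSymm T) (hp : IsPos T)
    {S : H →ₗ.[𝕜] H} (hs' : IsSymm S) (hp' : IsPos S) (hTS : T ≤ S) :
    Dominates (canonicalMap (formOf T hs hp))†† (canonicalMap (formOf S hs' hp'))†† := by
  have hd' : Dense (S.domain : Set H) := hd.mono hTS.1
  refine dominates_of_core (isClosed_adjoint_adjoint_canonicalMap hd' hs' hp')
    (graph_adjoint_adjoint_le hd (dense_domain_adjoint_canonicalMap hd hs hp)) ?_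
  rintro ⟨x, y⟩ hxy
  obtain ⟨g, rfl, rfl⟩ := (LinearPMap.mem_graph_iff _).1 hxy
  refine ⟨_, mem_graph_adjoint_adjoint_canonicalMap hd' hs' hp' ⟨g, hTS.1 g.2⟩,
    (sq_le_sq₀ (norm_nonneg _) (norm_nonneg _)).1 (le_of_eq ?_)⟩
  rw [← inner_self_eq_norm_sq (𝕜 := 𝕜), ← inner_self_eq_norm_sq (𝕜 := 𝕜)]
  refine congrArg RCLike.re ((inner_canonicalMap _ _ _).trans (Eq.trans ?_
    (inner_canonicalMap _ _ _).symm))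
  change inner 𝕜 (S ⟨g, _⟩) (g : H) = inner 𝕜 (T g) (g : H)
  rw [hTS.2 (x := g) (y := ⟨g, hTS.1 g.2⟩) rfl]

/-- Domination is chained from `B` through the closures `Q††` for `T` and for `S` to `A`; the outer
links compare operators with equal `P†P`. -/
theorem formLE_friedrichs (hd : Dense (T.domain : Set H)) (hs : IsSymm T) (hp : IsPos T)
    {S : H →ₗ.[𝕜] H} (hS : IsPosSelfAdjoint S) (hTS : T ≤ S) :
    FormLE S (friedrichs T hs hp) := by
  obtain ⟨A, hA⟩ := hS.exists_sqrt
  obtain ⟨B, hB⟩ := (isPosSelfAdjoint_friedrichs hd hs hp).exists_sqrt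
  have hSd := hS.1.dense_domain
  have h1 : Dominates B (canonicalMap (formOf T hs hp))†† :=
    dominates_of_adjoint_mul_self_le hB.1.1.isClosed hB.1.1.dense_domain
      (isClosed_adjoint_adjoint_canonicalMap hd hs hp)
      (dense_domain_adjoint_adjoint_canonicalMap hd hs hp)
      (by rw [hB.adjoint_mul_self, friedrichs_eq hd])
  have h2 : Dominates (canonicalMap (formOf S hS.isSymm hS.2))†† A :=
    dominates_of_adjoint_mul_self_le
      (isClosed_adjoint_adjoint_canonicalMap hSd hS.isSymm hS.2)
      (dense_domain_adjoint_adjoint_canonicalMap hSd hS.isSymm hS.2)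
      hA.1.1.isClosed hA.1.1.dense_domain
      (by rw [hA.adjoint_mul_self, ← friedrichs_eq hSd, hS.friedrichs_eq_self])
  have h3 := h1.trans ((dominates_canonicalMap hd hs hp hS.isSymm hS.2 hTS).trans h2)
  refine ⟨A, B, hA, hB, fun x hx => ?_, fun h => ?_⟩
  · obtain ⟨w, hw, -⟩ := h3 _ (B.mem_graph ⟨x, hx⟩)
    exact LinearPMap.mem_domain_of_mem_graph hw
  · obtain ⟨w, hw, hle⟩ := h3 _ (B.mem_graph h)
    rw [A.mem_graph_snd_inj (A.mem_graph ⟨h, _⟩) hw rfl]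
    exact pow_le_pow_left₀ (norm_nonneg _) hle 2

end FriedrichsExtension

end FormExt

theorem theorem3p1 {𝕜 : Type*} [RCLike 𝕜] {H : Type*} [NormedAddCommGroup H]
    [InnerProductSpace 𝕜 H] [CompleteSpace H] (T : H →ₗ.[𝕜] H)
    (hdense : Dense (T.domain : Set H)) (hsymm : FormExt.IsSymm T) (hpos : FormExt.IsPos T) :
    Dense ((FormExt.canonicalMap (FormExt.formOf T hsymm hpos))†.domain :
        Set (FormExt.FormSpace (FormExt.formOf T hsymm hpos))) ∧
    ∃ TF : H →ₗ.[𝕜] H,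
      TF = FormExt.opMul (FormExt.canonicalMap (FormExt.formOf T hsymm hpos))†
        (FormExt.canonicalMap (FormExt.formOf T hsymm hpos))†† ∧
      FormExt.IsPosSelfAdjoint TF ∧
      T ≤ TF ∧
      ∀ S : H →ₗ.[𝕜] H, FormExt.IsPosSelfAdjoint S → T ≤ S → FormExt.FormLE S TF := by
  exact ⟨FormExt.dense_domain_adjoint_canonicalMap hdense hsymm hpos,
    FormExt.friedrichs T hsymm hpos, rfl,
    FormExt.isPosSelfAdjoint_friedrichs hdense hsymm hpos,
    FormExt.le_friedrichs hdense hsymm hpos,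
    fun _ hS hTS => FormExt.formLE_friedrichs hdense hsymm hpos hS hTS⟩
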